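/- Let $(\mathcal{T},\otimes,\mathbf{1})$ be a tensor triangulated category, i.e. an essentially small triangulated category with a symmetric monoidal structure such that $\otimes$ is exact in each variable. A \emph{thick subcategory} of $\mathcal{T}$ is a full subcategory that contains $0$ and is closed under direct summands, shifts and extensions; let $\mathbf{Th}(\mathcal{T})$ be the set of thick subcategories, ordered by inclusion, with the topology whose closed subsets are the sets $\{\mathcal{X}\in\mathbf{Th}(\mathcal{T})\mid \mathcal{X}\cap\mathcal{E}=\emptyset\}$ for classes $\mathcal{E}$ of objects of $\mathcal{T}$. Let - $\mathrm{Spec}_\triangle(\mathcal{T})\subseteq\mathbf{Th}(\mathcal{T})$ be the subspace of \emph{prime thick subcategories}, i.e. the proper thick subcategories $\mathcal{P}$ such that $\{\mathcal{X}\in\mathbf{Th}(\mathcal{T})\mid\mathcal{P}\subsetneq\mathcal{X}\}$ has a smallest element; - $\mathrm{Spec}_\otimes(\mathcal{T})\subseteq\mathbf{Th}(\mathcal{T})$ (the Balmer spectrum) be the subspace of \emph{prime thick ideals}, i.e. the proper thick subcategories $\mathcal{P}$ such that $M\otimes N\in\mathcal{P}$ for all $M\in\mathcal{T}$, $N\in\mathcal{P}$,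 and such that $M\otimes N\in\mathcal{P}$ implies $M\in\mathcal{P}$ or $N\in\mathcal{P}$. Assume that $\mathcal{T}$ is idempotent complete; that it is rigid, i.e. each functor $M\otimes-$ has a right adjoint $[M,-]$ and the canonical maps $[M,\mathbf{1}]\otimes N\to[M,N]$ are isomorphisms for all $M,N\in\mathcal{T}$; that it is monogenic, i.e. the smallest thick subcategory containing $\mathbf{1}$ is $\mathcal{T}$; and that the topological space $\mathrm{Spec}_\otimes(\mathcal{T})$ is noetherian. Then $$\mathrm{Spec}_\triangle(\mathcal{T})=\mathrm{Spec}_\otimes(\mathcal{T})$$ as subsets (hence as subspaces) of $\mathbf{Th}(\mathcal{T})$: a thick subcategory of $\mathcal{T}$ is a prime thick subcategory if and only if it is a prime thick ideal. -/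

import Mathlib

open CategoryTheory CategoryTheory.Limits CategoryTheory.MonoidalCategory ZeroObject

universe w v u

namespace TTSpec

section Triangulated

variable (C : Type u) [Category.{v} C] [Preadditive C] [HasZeroObject C] [HasShift C ℤ]
  [∀ n : ℤ, (shiftFunctor C n).Additive] [Pretriangulated C]

/-- `Th(C)`: the thick subcategories of `C`, i.e. the full subcategories (given by a predicate on
objects) which contain a zero object and are closed under shifts, extensions and direct summands
(`P.IsTriangulated` is the conjunction of the first three; being a direct summand is expressed by
being a retract).  They are ordered by inclusion. -/
abbrev Thick : Type u :=
  {P : ObjectProperty C // P.IsTriangulated ∧ P.IsStableUnderRetracts}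

variable {C}

/-- `⟨M⟩`: the smallest thick subcategory containing the object `M`, constructed as the
intersection of all the thick subcategories containing `M`. -/
def thickClosure (M : C) : Thick C :=
  ⟨fun X => ∀ P : Thick C, P.1 M → P.1 X, by
    refine ⟨{ toContainsZero := ⟨0, isZero_zero C, ?_⟩
              toIsStableUnderShift := ⟨fun a => ⟨?_⟩⟩
              toIsTriangulatedClosed₂ := ⟨?_⟩ }, ⟨?_⟩⟩
    · intro P _
      have := P.2.1
      have := P.2.2
      exact P.1.prop_zero
    · intro X hX P hM
      have := P.2.1
      exact P.1.le_shift a _ (hX P hM)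
    · intro T hT h₁ h₃
      refine ObjectProperty.le_isoClosure _ _ fun P hM => ?_
      have := P.2.1
      have := P.2.2
      exact P.1.ext_of_isTriangulatedClosed₂ T hT (h₁ P hM) (h₃ P hM)
    · intro X Y r hY P hM
      have := P.2.2
      exact P.1.prop_of_retract r (hY P hM)⟩

/-- `⟨M⟩` is the least thick subcategory containing `M`. -/
theorem thickClosure_isLeast (M : C) : IsLeast {P : Thick C | P.1 M} (thickClosure M) :=
  ⟨fun _ h => h, fun P hP _ hX => hX P hP⟩

/-- `Z(E)`: the set of the thick subcategories which contain no object of `E`. -/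
def zeroLocus (E : Set C) : Set (Thick C) := {P | ∀ X ∈ E, ¬ P.1 X}

theorem zeroLocus_union (E F : Set C) :
    zeroLocus E ∪ zeroLocus F = zeroLocus {X | ∃ M ∈ E, ∃ N ∈ F, X = (M ⊞ N)} := by
  ext P
  have := P.2.1
  have := P.2.2
  constructor
  · rintro (h | h) _ ⟨M, hM, N, hN, rfl⟩ hP
    · exact h M hM (P.1.prop_of_retract ⟨biprod.inl, biprod.fst, by simp⟩ hP)
    · exact h N hN (P.1.prop_of_retract ⟨biprod.inr, biprod.snd, by simp⟩ hP)
  · intro h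
    by_contra hc
    simp only [Set.mem_union, zeroLocus, Set.mem_ofPred_eq, not_or, not_forall, not_not] at hc
    obtain ⟨⟨M, hM, hPM⟩, N, hN, hPN⟩ := hc
    refine h _ ⟨M, hM, N, hN, rfl⟩ ?_
    exact P.1.ext_of_isTriangulatedClosed₂ _ (Pretriangulated.binaryBiproductTriangle_distinguished M N)
      hPM hPN

/-- The topology on `Th(C)` whose closed subsets are exactly the sets `Z(E)`. -/
instance : TopologicalSpace (Thick C) :=
  TopologicalSpace.ofClosed (Set.range zeroLocus)
    ⟨Set.univ, by
      ext P
      have := P.2.1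
      have := P.2.2
      simp only [zeroLocus, Set.mem_ofPred_eq, Set.mem_empty_iff_false, iff_false]
      exact fun h => h 0 trivial P.1.prop_zero⟩
    (fun A hA => ⟨⋃₀ {E | zeroLocus E ∈ A}, by
      ext P
      constructor
      · intro h Z hZ
        obtain ⟨E, rfl⟩ := hA hZ
        exact fun X hX => h X ⟨E, hZ, hX⟩
      · rintro h X ⟨E, hE, hX⟩
        exact h _ hE X hX⟩)
    (by
      rintro _ ⟨E, rfl⟩ _ ⟨F, rfl⟩
      exact ⟨_, (zeroLocus_union E F).symm⟩)

theorem isClosed_iff_exists_zeroLocus (s : Set (Thick C)) :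
    IsClosed s ↔ ∃ E : Set C, zeroLocus E = s := by
  rw [← isOpen_compl_iff]
  change sᶜᶜ ∈ Set.range zeroLocus ↔ _
  rw [compl_compl]
  rfl

variable (C)

/-- The triangular spectrum: the set of the prime thick subcategories, i.e. of the proper thick
subcategories `P` such that `{X ∈ Th(C) | P ⊊ X}` has a smallest element.  As a subset of `Th(C)`,
it carries the induced topology. -/
def triangularSpectrum : Set (Thick C) :=
  {P | P.1 ≠ ⊤ ∧ ∃ X : Thick C, IsLeast {Y : Thick C | P < Y} X}

end Triangulated

section TensorTriangulated

/-- A functor between triangulated categories is exact if it can be equipped with isomorphisms of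
commutation with the shifts for which it sends distinguished triangles to distinguished
triangles. -/
def IsExactFunctor {C D : Type*} [Category* C] [Category* D]
    [Preadditive C] [HasZeroObject C] [HasShift C ℤ]
    [∀ n : ℤ, (shiftFunctor C n).Additive] [Pretriangulated C]
    [Preadditive D] [HasZeroObject D] [HasShift D ℤ]
    [∀ n : ℤ, (shiftFunctor D n).Additive] [Pretriangulated D] (F : C ⥤ D) : Prop :=
  ∃ _ : F.CommShift ℤ, F.IsTriangulated

variable (C : Type u) [Category.{v} C] [Preadditive C] [HasZeroObject C] [HasShift C ℤ]
  [∀ n : ℤ, (shiftFunctor C n).Additive] [Pretriangulated C] [MonoidalCategory C]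

/-- The compatibility between the triangulated structure and the (symmetric) monoidal structure of
a tensor triangulated category: the tensor product is exact in each variable. -/
structure TensorExact : Prop where
  exact_tensorLeft (M : C) : IsExactFunctor (tensorLeft M)
  exact_tensorRight (M : C) : IsExactFunctor (tensorRight M)

/-- A thick subcategory `P` is a prime thick ideal if it is proper, if `M ⊗ N ∈ P` for all
`M ∈ C` and `N ∈ P`, and if `M ⊗ N ∈ P` implies `M ∈ P` or `N ∈ P`. -/
structure IsPrimeThickIdeal {C : Type u} [Category.{v} C] [Preadditive C] [HasZeroObject C]
    [HasShift C ℤ] [∀ n : ℤ, (shiftFunctor C n).Additive] [Pretriangulated C]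
    [MonoidalCategory C] (P : Thick C) : Prop where
  proper : P.1 ≠ ⊤
  ideal (M N : C) : P.1 N → P.1 (M ⊗ N)
  prime (M N : C) : P.1 (M ⊗ N) → P.1 M ∨ P.1 N

/-- The Balmer spectrum: the set of the prime thick ideals.  As a subset of `Th(C)`, it carries the
induced topology. -/
def balmerSpectrum : Set (Thick C) := {P | IsPrimeThickIdeal P}

/-- `C` is monogenic if it is generated by its unit object: `C = ⟨𝟙⟩`. -/
def IsMonogenic : Prop := (thickClosure (𝟙_ C)).1 = ⊤

end TensorTriangulated

section Rigid

variable {C : Type u} [Category.{v} C] [MonoidalCategory C] [MonoidalClosed C]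

/-- The canonical map `[M, 𝟙] ⊗ N ⟶ [M, N]`, which is adjoint to the map
`M ⊗ ([M, 𝟙] ⊗ N) ≅ (M ⊗ [M, 𝟙]) ⊗ N ⟶ 𝟙 ⊗ N ≅ N` induced by the evaluation. -/
def dualTensorHom (M N : C) : (ihom M).obj (𝟙_ C) ⊗ N ⟶ (ihom M).obj N :=
  MonoidalClosed.curry
    ((α_ M ((ihom M).obj (𝟙_ C)) N).inv ≫ (ihom.ev M).app (𝟙_ C) ▷ N ≫ (λ_ N).hom)

variable (C) in
/-- A closed monoidal category is rigid if every object `M` is strongly dualizable, i.e. if the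
canonical maps `[M, 𝟙] ⊗ N ⟶ [M, N]` are isomorphisms for all `N`. -/
def IsRigid : Prop := ∀ M N : C, IsIso (dualTensorHom M N)

end Rigid

end TTSpec

/-! Generation by the unit makes every thick subcategory an ideal, and duality makes it radical.
Zorn's lemma then separates any thick subcategory from any object outside it by a prime ideal
(`exists_isPrimeThickIdeal_notMem`). If `P` has a least strict enlargement and is not itself a prime
ideal, all primes above `P` contain that enlargement, yet they intersect in `P`. Conversely,
noetherianity gives a prime `P` an object `M` outside it such that every prime omitting `M` lies
below `P` (`exists_supp_le`). So `M` lies in everything strictly above `P`. -/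

namespace TTSpec

section Triangulated

variable {C : Type u} [Category.{v} C] [Preadditive C] [HasZeroObject C] [HasShift C ℤ]
  [∀ n : ℤ, (shiftFunctor C n).Additive] [Pretriangulated C]

/-- The intersection of a set of thick subcategories. -/
def thickInter (S : Set (Thick C)) : Thick C :=
  ⟨fun X => ∀ P ∈ S, P.1 X, by
    refine ⟨{ toContainsZero := ⟨0, isZero_zero C, ?_⟩
              toIsStableUnderShift := ⟨fun a => ⟨?_⟩⟩
              toIsTriangulatedClosed₂ := ⟨?_⟩ }, ⟨?_⟩⟩
    · intro P _
      have := P.2.1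
      have := P.2.2
      exact P.1.prop_zero
    · intro X hX P hP
      have := P.2.1
      exact P.1.le_shift a _ (hX P hP)
    · intro T hT h₁ h₃
      refine ObjectProperty.le_isoClosure _ _ fun P hP => ?_
      have := P.2.1
      have := P.2.2
      exact P.1.ext_of_isTriangulatedClosed₂ T hT (h₁ P hP) (h₃ P hP)
    · intro X Y r hY P hP
      have := P.2.2
      exact P.1.prop_of_retract r (hY P hP)⟩

/-- The union of a nonempty chain of thick subcategories. -/
def thickUnion (S : Set (Thick C)) (hS : IsChain (· ≤ ·) S) (hne : S.Nonempty) : Thick C :=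
  ⟨fun X => ∃ P ∈ S, P.1 X, by
    refine ⟨{ toContainsZero := ⟨0, isZero_zero C, ?_⟩
              toIsStableUnderShift := ⟨fun a => ⟨?_⟩⟩
              toIsTriangulatedClosed₂ := ⟨?_⟩ }, ⟨?_⟩⟩
    · obtain ⟨P, hP⟩ := hne
      have := P.2.1
      have := P.2.2
      exact ⟨P, hP, P.1.prop_zero⟩
    · rintro X ⟨P, hP, hX⟩
      have := P.2.1
      exact ⟨P, hP, P.1.le_shift a _ hX⟩
    · rintro T hT ⟨P, hP, h₁⟩ ⟨Q, hQ, h₃⟩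
      refine ObjectProperty.le_isoClosure _ _ ?_
      obtain ⟨R, hR, hPR, hQR⟩ : ∃ R ∈ S, P ≤ R ∧ Q ≤ R := by
        rcases hS.total hP hQ with h | h
        · exact ⟨Q, hQ, h, le_rfl⟩
        · exact ⟨P, hP, le_rfl, h⟩
      have := R.2.1
      have := R.2.2
      exact ⟨R, hR, R.1.ext_of_isTriangulatedClosed₂ T hT (hPR _ h₁) (hQR _ h₃)⟩
    · rintro X Y r ⟨P, hP, hY⟩
      have := P.2.2
      exact ⟨P, hP, P.1.prop_of_retract r hY⟩⟩

/-- The preimage of a thick subcategory under an exact functor is thick. -/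
theorem IsExactFunctor.thick_inverseImage {F : C ⥤ C} (hF : IsExactFunctor F) (P : Thick C) :
    (P.1.inverseImage F).IsTriangulated ∧ (P.1.inverseImage F).IsStableUnderRetracts := by
  obtain ⟨_, _⟩ := hF
  have := P.2.1
  have := P.2.2
  exact ⟨inferInstance, ⟨fun r hY => P.1.prop_of_retract (r.map F) hY⟩⟩

/-- Among the thick subcategories which contain `P` but not `M`, there is a maximal one. -/
theorem exists_maximal_thick_notMem (P : Thick C) {M : C} (hM : ¬ P.1 M) :
    ∃ Q, P ≤ Q ∧ Maximal (fun R : Thick C => ¬ R.1 M) Q := by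
  refine zorn_le_nonempty₀ {R : Thick C | ¬ R.1 M} (fun c hc hchain Y hY => ?_) P hM
  refine ⟨thickUnion c hchain ⟨Y, hY⟩, ?_, fun Z hZ X hX => ⟨Z, hZ, hX⟩⟩
  rintro ⟨R, hR, h⟩
  exact hc hR h

end Triangulated

section Rigid

variable {C : Type u} [Category.{v} C] [MonoidalCategory C] [MonoidalClosed C]

/-- A strongly dualizable object `M` is a retract of `M ⊗ (M^* ⊗ M)`. -/
theorem IsRigid.nonempty_retract (h : IsRigid C) (M : C) :
    Nonempty (Retract M (M ⊗ ((ihom M).obj (𝟙_ C) ⊗ M))) := by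
  have := h M M
  -- Coevaluation `𝟙 ⟶ [M, M] ≅ M^* ⊗ M` followed by evaluation: a triangle identity.
  refine ⟨⟨(ρ_ M).inv ≫ M ◁ (MonoidalClosed.curry (ρ_ M).hom ≫ inv (dualTensorHom M M)),
    MonoidalClosed.uncurry (dualTensorHom M M), ?_⟩⟩
  rw [Category.assoc, ← MonoidalClosed.uncurry_natural_left, Category.assoc, IsIso.inv_hom_id,
    Category.comp_id, MonoidalClosed.uncurry_curry, Iso.inv_hom_id]

end Rigid

section TensorTriangulated

variable {C : Type u} [Category.{v} C] [Preadditive C] [HasZeroObject C] [HasShift C ℤ]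
  [∀ n : ℤ, (shiftFunctor C n).Additive] [Pretriangulated C] [MonoidalCategory C]

/-- If the unit object generates, then every thick subcategory is an ideal. -/
theorem IsMonogenic.tensor_mem (hmono : IsMonogenic C) (htt : TensorExact C) (P : Thick C)
    (M : C) {N : C} (hN : P.1 N) : P.1 (M ⊗ N) := by
  have := P.2.2
  have hM : (thickClosure (𝟙_ C)).1 M := by
    rw [hmono]
    trivial
  -- The objects `Z` with `Z ⊗ N ∈ P` form a thick subcategory containing `𝟙`.
  exact hM ⟨_, (htt.exact_tensorRight N).thick_inverseImage P⟩
    (P.1.prop_of_iso (λ_ N).symm hN)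

/-- The support of an object, as a closed subset of the Balmer spectrum. -/
def supp (M : C) : TopologicalSpace.Closeds (balmerSpectrum C) where
  carrier := Subtype.val ⁻¹' zeroLocus {M}
  isClosed' := ((isClosed_iff_exists_zeroLocus _).2 ⟨_, rfl⟩).preimage continuous_subtype_val

theorem mem_supp_iff {M : C} {Q : balmerSpectrum C} : Q ∈ supp M ↔ ¬ Q.1.1 M := by
  change (∀ X ∈ ({M} : Set C), ¬ Q.1.1 X) ↔ _
  simp

variable [BraidedCategory C]

theorem mem_tensor_comm (P : Thick C) {M N : C} (h : P.1 (M ⊗ N)) : P.1 (N ⊗ M) := by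
  have := P.2.2
  exact P.1.prop_of_iso (β_ M N) h

/-- If the Balmer spectrum is noetherian, then the closure `{Q | Q ≤ P}` of a point `P` contains
the support of an object outside `P`. -/
theorem exists_supp_le [TopologicalSpace.NoetherianSpace (balmerSpectrum C)] {P : Thick C}
    (hP : IsPrimeThickIdeal P) :
    ∃ M, ¬ P.1 M ∧ ∀ Q, IsPrimeThickIdeal Q → ¬ Q.1 M → Q ≤ P := by
  have hne : {M : C | ¬ P.1 M}.Nonempty := by
    by_contra h
    refine hP.proper (funext fun M => eq_true ?_)
    by_contra hM
    exact h ⟨M, hM⟩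
  -- Noetherianity provides an object outside `P` of minimal support. For `N ∉ P`, primality keeps
  -- `M ⊗ N` outside `P`, so tensoring with `N` cannot shrink this support; a prime omitting `M`
  -- therefore omits `N`.
  obtain ⟨_, ⟨M, hM, rfl⟩, hmin⟩ := WellFounded.has_min
    (wellFounded_lt (α := TopologicalSpace.Closeds (balmerSpectrum C)))
    (supp '' {M : C | ¬ P.1 M}) (hne.image _)
  refine ⟨M, hM, fun Q hQ hQM N hN => ?_⟩
  by_contra hPN
  have hle : supp (M ⊗ N) ≤ supp M := fun R hR =>
    mem_supp_iff.2 fun hRM => mem_supp_iff.1 hR (mem_tensor_comm R.1 (R.2.ideal N M hRM))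
  have hmem : supp (M ⊗ N) ∈ supp '' {M : C | ¬ P.1 M} :=
    ⟨_, fun h => (hP.prime M N h).elim hM hPN, rfl⟩
  have hge : supp M ≤ supp (M ⊗ N) :=
    (eq_of_le_of_not_lt hle (hmin _ hmem)).ge
  exact mem_supp_iff.1 (hge (x := ⟨Q, hQ⟩) (mem_supp_iff.2 hQM)) (hQ.ideal M N hN)

variable [MonoidalClosed C]

/-- If the category is rigid and generated by its unit object, then every thick subcategory is
radical. -/
theorem mem_of_tensor_self_mem (htt : TensorExact C) (hrigid : IsRigid C)
    (hmono : IsMonogenic C) (P : Thick C) {M : C} (h : P.1 (M ⊗ M)) : P.1 M := by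
  have := P.2.2
  obtain ⟨r⟩ := hrigid.nonempty_retract M
  refine P.1.prop_of_retract r (mem_tensor_comm P ?_)
  exact P.1.prop_of_iso (α_ _ _ _).symm (hmono.tensor_mem htt P _ h)

/-- A thick subcategory which is maximal among those not containing an object `M` is a prime
ideal. -/
theorem isPrimeThickIdeal_of_maximal (htt : TensorExact C) (hrigid : IsRigid C)
    (hmono : IsMonogenic C) {Q : Thick C} {M : C}
    (hQ : Maximal (fun R : Thick C => ¬ R.1 M) Q) : IsPrimeThickIdeal Q where
  proper h := hQ.prop (by rw [h]; trivial)
  ideal A _ hB := hmono.tensor_mem htt Q A hB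
  prime A B hAB := by
    by_contra! hc
    -- a thick subcategory of the form `{Z | Z ⊗ E ∈ Q}` contains `M` once it exceeds `Q`
    have key {D E : C} (hD : ¬ Q.1 D) (hDE : Q.1 (D ⊗ E)) : Q.1 (M ⊗ E) := by
      by_contra hM
      exact hD (hQ.le_of_ge
        (y := ⟨_, (htt.exact_tensorRight E).thick_inverseImage Q⟩) hM
        (fun Z hZ => mem_tensor_comm Q (hmono.tensor_mem htt Q E hZ)) _ hDE)
    -- From `A ⊗ B ∈ Q`, replace `A` by `M`, then `B` by `M`; radicality turns `M ⊗ M ∈ Q` into `M ∈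
    -- Q`.
    exact hQ.prop (mem_of_tensor_self_mem htt hrigid hmono Q
      (key hc.2 (mem_tensor_comm Q (key hc.1 hAB))))

/-- Every thick subcategory is an intersection of prime thick ideals. -/
theorem exists_isPrimeThickIdeal_notMem (htt : TensorExact C) (hrigid : IsRigid C)
    (hmono : IsMonogenic C) (P : Thick C) {M : C} (hM : ¬ P.1 M) :
    ∃ Q, IsPrimeThickIdeal Q ∧ P ≤ Q ∧ ¬ Q.1 M := by
  obtain ⟨Q, hPQ, hQ⟩ := exists_maximal_thick_notMem P hM
  exact ⟨Q, isPrimeThickIdeal_of_maximal htt hrigid hmono hQ, hPQ, hQ.prop⟩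

theorem isPrimeThickIdeal_of_mem_triangularSpectrum (htt : TensorExact C) (hrigid : IsRigid C)
    (hmono : IsMonogenic C) {P : Thick C} (hP : P ∈ triangularSpectrum C) :
    IsPrimeThickIdeal P := by
  obtain ⟨-, X, hPX, hX⟩ := hP
  by_contra hnot
  refine (show P < X from hPX).not_ge fun M hM => ?_
  by_contra hPM
  obtain ⟨Q, hQ, hPQ, hQM⟩ := exists_isPrimeThickIdeal_notMem htt hrigid hmono P hPM
  -- `Q` is prime and `P` is not, so `P < Q` and hence `X ≤ Q`.
  exact hQM (hX (lt_of_le_of_ne hPQ (by rintro rfl; exact hnot hQ)) _ hM)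

theorem mem_triangularSpectrum_of_isPrimeThickIdeal
    [TopologicalSpace.NoetherianSpace (balmerSpectrum C)]
    (htt : TensorExact C) (hrigid : IsRigid C) (hmono : IsMonogenic C) {P : Thick C}
    (hP : IsPrimeThickIdeal P) : P ∈ triangularSpectrum C := by
  obtain ⟨M, hM, hsupp⟩ := exists_supp_le hP
  refine ⟨hP.proper, thickInter {Y | P < Y},
    show P < thickInter {Y | P < Y} from lt_of_le_not_ge ?_ fun h => hM (h M ?_),
    fun Y hY X hX => hX Y hY⟩
  · exact fun X hX Y hY => (show P < Y from hY).le X hX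
  · intro Y hPY
    by_contra hYM
    obtain ⟨Q, hQ, hYQ, hQM⟩ := exists_isPrimeThickIdeal_notMem htt hrigid hmono Y hYM
    -- If `Y` omitted `M`, then `Y ≤ Q ≤ P`, against `P < Y`.
    exact hPY.not_ge (hYQ.trans (hsupp Q hQ hQM))

end TensorTriangulated

end TTSpec

theorem mainTheorem10 (C : Type u) [Category.{v} C] [EssentiallySmall.{w} C]
    [Preadditive C] [HasZeroObject C] [HasShift C ℤ] [∀ n : ℤ, (shiftFunctor C n).Additive]
    [Pretriangulated C] [IsTriangulated C]
    [MonoidalCategory C] [SymmetricCategory C] (htt : TTSpec.TensorExact C)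
    [IsIdempotentComplete C]
    [MonoidalClosed C] (hrigid : TTSpec.IsRigid C)
    (hmono : TTSpec.IsMonogenic C)
    (hnoeth : TopologicalSpace.NoetherianSpace (TTSpec.balmerSpectrum C)) :
    TTSpec.triangularSpectrum C = TTSpec.balmerSpectrum C := by
  ext P
  exact ⟨TTSpec.isPrimeThickIdeal_of_mem_triangularSpectrum htt hrigid hmono,
    TTSpec.mem_triangularSpectrum_of_isPrimeThickIdeal htt hrigid hmono⟩
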